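/- Let $\Omega\subset\mathbb R^2$ be an open set containing the origin and let $\mathbf F:\Omega\to\mathbb R^2$ be a $C^2$ vector field with $\mathbf F(\mathbf 0)=\mathbf 0$. A Helmholtz–Hodge decomposition (HHD) of $\mathbf F$ on $\Omega$ is a decomposition $\mathbf F=-\nabla V+\mathbf u$ on $\Omega$ with $V:\Omega\to\mathbb R$ of class $C^3$ (a potential function) and $\mathbf u$ a $C^2$ vector field on $\Omega$ with $\nabla\cdot\mathbf u=0$. Let $\alpha$ be an integrable real function on $[0,2\pi]$, and for $k\ge 1$ let $$a_k=\frac1\pi\int_0^{2\pi}\alpha(\theta)\cos(k\theta)\,d\theta,\qquad b_k=\frac1\pi\int_0^{2\pi}\alpha(\theta)\sin(k\theta)\,d\theta$$ be its Fourier coefficients. Let $h$ be the harmonic function on the open unit disk given by $$h(x,y)=\frac1{2\pi}\int_0^{2\pi}\alpha(\theta)\,\frac{1-x^2-y^2}{(x-\cos\theta)^2+(y-\sin\theta)^2}\,d\theta .$$ Suppose that $a_1=b_1=0$. 1. If $V$ is a potential function of an HHD of $\mathbf F$ on $\Omega$ and $V$ has a (local) minimum at $\mathbf 0$, then $V+h$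 is differentiable at $\mathbf 0$ and $\nabla(V+h)(\mathbf 0)=\mathbf 0$. 2. Suppose that $\nabla\cdot\mathbf F(\mathbf 0)<0$. Let $W$ be a potential function of any HHD of $\mathbf F$ on $\Omega$, put $\rho=\operatorname{tr}\operatorname{Hess}W(\mathbf 0)$ and $A=-\operatorname{Hess}W(\mathbf 0)+\frac{\rho}{2}I$, and let $$V(\mathbf x)=W(\mathbf x)-\nabla W(\mathbf 0)\cdot\mathbf x+\tfrac12\,{}^t\mathbf x A\mathbf x .$$ If $$a_2^2+b_2^2<\frac{(\operatorname{tr}D\mathbf F_{\mathbf 0})^2}{64},$$ where $D\mathbf F_{\mathbf 0}$ is the Jacobian matrix of $\mathbf F$ at $\mathbf 0$, then $V+h$ has a local minimum at $\mathbf 0$, and this local minimum is strict. -/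

import Mathlib

open Set Filter Topology MeasureTheory

/-- The Jacobian matrix `(∂F_i/∂x_j)(x)` of a vector field on `ℝⁿ`. -/
noncomputable def jacobianMatrix {n : ℕ}
    (F : EuclideanSpace ℝ (Fin n) → EuclideanSpace ℝ (Fin n))
    (x : EuclideanSpace ℝ (Fin n)) : Matrix (Fin n) (Fin n) ℝ :=
  Matrix.of fun i j => fderiv ℝ F x (EuclideanSpace.single j 1) i

/-- The divergence `∑ᵢ ∂F_i/∂x_i` of a vector field on `ℝⁿ`. -/
noncomputable def vfDivergence {n : ℕ}
    (F : EuclideanSpace ℝ (Fin n) → EuclideanSpace ℝ (Fin n))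
    (x : EuclideanSpace ℝ (Fin n)) : ℝ :=
  ∑ i, fderiv ℝ F x (EuclideanSpace.single i 1) i

/-- The Hessian matrix `(∂²f/∂x_i∂x_j)(x)` of a function on `ℝⁿ`. -/
noncomputable def hessianMatrix {n : ℕ} (f : EuclideanSpace ℝ (Fin n) → ℝ)
    (x : EuclideanSpace ℝ (Fin n)) : Matrix (Fin n) (Fin n) ℝ :=
  Matrix.of fun i j =>
    fderiv ℝ (fun y => fderiv ℝ f y (EuclideanSpace.single j 1)) x (EuclideanSpace.single i 1)

/-- `F = -∇V + u` is a Helmholtz--Hodge decomposition of `F` on `Ω`, with potential function `V`. -/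
structure IsHHD {n : ℕ} (Ω : Set (EuclideanSpace ℝ (Fin n)))
    (F : EuclideanSpace ℝ (Fin n) → EuclideanSpace ℝ (Fin n))
    (V : EuclideanSpace ℝ (Fin n) → ℝ)
    (u : EuclideanSpace ℝ (Fin n) → EuclideanSpace ℝ (Fin n)) : Prop where
  contDiffOn_potential : ContDiffOn ℝ 3 V Ω
  contDiffOn_field : ContDiffOn ℝ 2 u Ω
  decomposition : ∀ x ∈ Ω, F x = -gradient V x + u x
  divergence_eq_zero : ∀ x ∈ Ω, vfDivergence u x = 0

/-- The trace-free matrix `A = -Hess W(0) + (ρ/n) I`, where `ρ = tr Hess W(0)`. -/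
noncomputable def correctionMatrix {n : ℕ} (W : EuclideanSpace ℝ (Fin n) → ℝ) :
    Matrix (Fin n) (Fin n) ℝ :=
  -hessianMatrix W 0 + ((hessianMatrix W 0).trace / n) • (1 : Matrix (Fin n) (Fin n) ℝ)

/-- The potential `x ↦ W(x) - ∇W(0)·x + ½ ᵗx A x`, obtained from a potential `W` by adding
harmonic polynomials, so that its gradient at `0` vanishes and its Hessian at `0` is `(ρ/n) I`. -/
noncomputable def correctedPotential {n : ℕ} (W : EuclideanSpace ℝ (Fin n) → ℝ)
    (x : EuclideanSpace ℝ (Fin n)) : ℝ :=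
  W x - inner ℝ (gradient W 0) x
    + (1 / 2) * (x.ofLp ⬝ᵥ (correctionMatrix W).mulVec x.ofLp)

/-- `V` is, on `Ω`, the potential constructed from some Helmholtz--Hodge decomposition
`F = -∇W + w` by the above correction. -/
def IsConstructedPotential {n : ℕ} (Ω : Set (EuclideanSpace ℝ (Fin n)))
    (F : EuclideanSpace ℝ (Fin n) → EuclideanSpace ℝ (Fin n))
    (V : EuclideanSpace ℝ (Fin n) → ℝ) : Prop :=
  ∃ (W : EuclideanSpace ℝ (Fin n) → ℝ)
    (w : EuclideanSpace ℝ (Fin n) → EuclideanSpace ℝ (Fin n)),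
    IsHHD Ω F W w ∧ EqOn V (correctedPotential W) Ω

/-- The Poisson kernel `K(x, y, θ)` of the unit disk. -/
noncomputable def diskPoissonKernel (p : EuclideanSpace ℝ (Fin 2)) (θ : ℝ) : ℝ :=
  (1 - p 0 ^ 2 - p 1 ^ 2) / ((p 0 - Real.cos θ) ^ 2 + (p 1 - Real.sin θ) ^ 2)

/-- The function `(1/2π) ∫₀^{2π} α(θ) K(x, y, θ) dθ` on the unit disk. -/
noncomputable def diskPoissonIntegral (α : ℝ → ℝ) (p : EuclideanSpace ℝ (Fin 2)) : ℝ :=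
  1 / (2 * Real.pi) * ∫ θ in (0 : ℝ)..(2 * Real.pi), α θ * diskPoissonKernel p θ

/-- For `k ≥ 1`, the coefficient `a_k` of `cos (k θ)` in the Fourier series of `α`. -/
noncomputable def fourierCosCoeff (α : ℝ → ℝ) (k : ℕ) : ℝ :=
  1 / Real.pi * ∫ θ in (0 : ℝ)..(2 * Real.pi), α θ * Real.cos (k * θ)

/-- For `k ≥ 1`, the coefficient `b_k` of `sin (k θ)` in the Fourier series of `α`. -/
noncomputable def fourierSinCoeff (α : ℝ → ℝ) (k : ℕ) : ℝ :=
  1 / Real.pi * ∫ θ in (0 : ℝ)..(2 * Real.pi), α θ * Real.sin (k * θ)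

theorem isLittleO_sub_taylor_two {E : Type*} [NormedAddCommGroup E] [NormedSpace ℝ E]
    {f : E → ℝ} {f' : E → E →L[ℝ] ℝ} {f'' : E →L[ℝ] E →L[ℝ] ℝ} {a : E}
    (hf : ∀ᶠ x in 𝓝 a, HasFDerivAt f (f' x) x) (hf' : HasFDerivAt f' f'' a) :
    (fun x => f x - f a - f' a (x - a) - (1 / 2) * f'' (x - a) (x - a))
      =o[𝓝 a] fun x => ‖x - a‖ ^ 2 := by
  have hsymm := second_derivative_symmetric_of_eventually hf hf'
  have hlin := hf'.isLittleO
  rw [Asymptotics.isLittleO_iff] at hlin ⊢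
  intro c hc
  obtain ⟨r, hr, hball⟩ := Metric.eventually_nhds_iff_ball.1 (hf.and (hlin hc))
  filter_upwards [Metric.ball_mem_nhds a hr] with x hx
  set g : E → ℝ := fun y => f y - f' a (y - a) - (1 / 2) * f'' (y - a) (y - a) with hg
  have hderiv : ∀ y ∈ Metric.ball a r, HasFDerivAt g (f' y - f' a - f'' (y - a)) y := by
    intro y hy
    have hsub : HasFDerivAt (fun z : E => z - a) (ContinuousLinearMap.id ℝ E) y :=
      (hasFDerivAt_id y).sub_const a
    have h1 := (f' a).hasFDerivAt.comp y hsub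
    have h2 := ((f''.hasFDerivAt.comp y hsub).clm_apply hsub).const_mul (1 / 2)
    refine (((hball y hy).1.sub h1).sub h2).congr_fderiv ?_
    ext v
    have hv := hsymm v (y - a)
    simp only [map_sub, sub_apply] at hv
    simp
    linarith
  have hseg : segment ℝ a x ⊆ Metric.ball a r :=
    (convex_ball a r).segment_subset (Metric.mem_ball_self hr) hx
  have hmv := (convex_segment (𝕜 := ℝ) a x).norm_image_sub_le_of_norm_hasFDerivWithin_le
    (f := g) (f' := fun y => f' y - f' a - f'' (y - a)) (C := c * ‖x - a‖)
    (fun y hy => (hderiv y (hseg hy)).hasFDerivWithinAt)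
    (fun y hy => (hball y (hseg hy)).2.trans
      (mul_le_mul_of_nonneg_left (by simpa [norm_sub_rev] using norm_sub_le_of_mem_segment hy) hc.le))
    (left_mem_segment ℝ a x) (right_mem_segment ℝ a x)
  have : g x - g a = f x - f a - f' a (x - a) - (1 / 2) * f'' (x - a) (x - a) := by
    simp [hg]; ring
  rw [this] at hmv
  simpa [pow_two, mul_assoc] using hmv

theorem hessianMatrix_apply {n : ℕ} {f : EuclideanSpace ℝ (Fin n) → ℝ}
    {x : EuclideanSpace ℝ (Fin n)} (hf : DifferentiableAt ℝ (fderiv ℝ f) x) (i j : Fin n) :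
    hessianMatrix f x i j = fderiv ℝ (fderiv ℝ f) x (EuclideanSpace.single i 1)
      (EuclideanSpace.single j 1) := by
  have h := hf.hasFDerivAt.clm_apply
    (hasFDerivAt_const (EuclideanSpace.single j (1 : ℝ)) x)
  simp [hessianMatrix, h.fderiv]

theorem bilin_self_eq_dotProduct_mulVec {n : ℕ}
    (B : EuclideanSpace ℝ (Fin n) →L[ℝ] EuclideanSpace ℝ (Fin n) →L[ℝ] ℝ)
    (x : EuclideanSpace ℝ (Fin n)) :
    B x x = x.ofLp ⬝ᵥ (Matrix.of fun i j => B (EuclideanSpace.single i 1)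
      (EuclideanSpace.single j 1)).mulVec x.ofLp := by
  have hx : x = ∑ i, x i • EuclideanSpace.single i (1 : ℝ) := by
    ext j; simp [Finset.sum_apply, Pi.single_apply]
  conv_lhs => rw [hx]
  simp only [map_sum, map_smul, FunLike.coe_sum, Finset.sum_apply, smul_apply,
    smul_eq_mul, dotProduct, Matrix.mulVec, Matrix.of_apply, Finset.mul_sum]
  exact Finset.sum_comm.trans (Finset.sum_congr rfl fun i _ => Finset.sum_congr rfl fun j _ => by ring)

theorem gradient_apply {n : ℕ} {f : EuclideanSpace ℝ (Fin n) → ℝ}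
    (x : EuclideanSpace ℝ (Fin n)) (i : Fin n) :
    gradient f x i = fderiv ℝ f x (EuclideanSpace.single i 1) := by
  have : inner ℝ (gradient f x) (EuclideanSpace.single i (1 : ℝ))
      = fderiv ℝ f x (EuclideanSpace.single i 1) := by
    rw [gradient, InnerProductSpace.toDual_symm_apply]
  rw [← this, EuclideanSpace.inner_single_right]
  simp

theorem fderiv_euclidean_apply {n : ℕ} {G : EuclideanSpace ℝ (Fin n) → EuclideanSpace ℝ (Fin n)}
    {x : EuclideanSpace ℝ (Fin n)} (hG : DifferentiableAt ℝ G x) (v : EuclideanSpace ℝ (Fin n))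
    (i : Fin n) : fderiv ℝ G x v i = fderiv ℝ (fun y => G y i) x v := by
  have h := ((EuclideanSpace.proj i : EuclideanSpace ℝ (Fin n) →L[ℝ] ℝ).hasFDerivAt.comp x
    hG.hasFDerivAt).fderiv
  exact (congrArg (fun L => L v) h).symm

/-- The Laplacian of a potential is minus the divergence of the vector field. -/
theorem IsHHD.trace_hessianMatrix {n : ℕ} {Ω : Set (EuclideanSpace ℝ (Fin n))}
    {F u : EuclideanSpace ℝ (Fin n) → EuclideanSpace ℝ (Fin n)}
    {W : EuclideanSpace ℝ (Fin n) → ℝ} (hW : IsHHD Ω F W u) (hΩ : IsOpen Ω)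
    (hF : ContDiffOn ℝ 2 F Ω) {x : EuclideanSpace ℝ (Fin n)} (hx : x ∈ Ω) :
    (hessianMatrix W x).trace = -vfDivergence F x := by
  have hΩx := hΩ.mem_nhds hx
  have hFx : DifferentiableAt ℝ F x := (hF.contDiffAt hΩx).differentiableAt (by norm_num)
  have hux : DifferentiableAt ℝ u x :=
    (hW.contDiffOn_field.contDiffAt hΩx).differentiableAt (by norm_num)
  have hdW : DifferentiableAt ℝ (fderiv ℝ W) x :=
    ((hW.contDiffOn_potential.contDiffAt hΩx).fderiv_right (m := 2) (by norm_num)).differentiableAt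
      (by norm_num)
  have hdiv := hW.divergence_eq_zero x hx
  have key : ∀ i, fderiv ℝ F x (EuclideanSpace.single i 1) i
      = -hessianMatrix W x i i + fderiv ℝ u x (EuclideanSpace.single i 1) i := by
    intro i
    rw [fderiv_euclidean_apply hFx, fderiv_euclidean_apply hux]
    have hEq : (fun y => F y i) =ᶠ[𝓝 x]
        fun y => -fderiv ℝ W y (EuclideanSpace.single i 1) + u y i := by
      filter_upwards [hΩx] with y hy
      rw [hW.decomposition y hy, ← gradient_apply]
      simp
    have hd1 : DifferentiableAt ℝ (fun y => fderiv ℝ W y (EuclideanSpace.single i 1)) x :=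
      hdW.clm_apply (differentiableAt_const _)
    have hd2 : DifferentiableAt ℝ (fun y => u y i) x :=
      (EuclideanSpace.proj i : EuclideanSpace ℝ (Fin n) →L[ℝ] ℝ).differentiableAt.comp x hux
    rw [hEq.fderiv_eq, fderiv_fun_add hd1.fun_neg hd2]
    simp [hessianMatrix, fderiv_fun_neg]
  simp only [vfDivergence] at hdiv ⊢
  simp only [key, Finset.sum_add_distrib, hdiv, Finset.sum_neg_distrib, Matrix.trace, Matrix.diag]
  ring

theorem correctedPotential_isLittleO {n : ℕ} {W : EuclideanSpace ℝ (Fin n) → ℝ}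
    (hW : ContDiffAt ℝ 2 W 0) :
    (fun x => correctedPotential W x - correctedPotential W 0
        - (hessianMatrix W 0).trace / (2 * n) * ‖x‖ ^ 2)
      =o[𝓝 0] fun x => ‖x‖ ^ 2 := by
  have hd : DifferentiableAt ℝ (fderiv ℝ W) 0 :=
    (hW.fderiv_right (m := 1) (by norm_num)).differentiableAt (by norm_num)
  have hev : ∀ᶠ x in 𝓝 0, HasFDerivAt W (fderiv ℝ W x) x := by
    filter_upwards [hW.eventually (by simp)] with x hx
    exact (hx.differentiableAt (by norm_num)).hasFDerivAt
  have h := isLittleO_sub_taylor_two hev hd.hasFDerivAt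
  simp only [sub_zero] at h
  refine h.congr_left fun x => ?_
  have hH : (Matrix.of fun i j => fderiv ℝ (fderiv ℝ W) 0 (EuclideanSpace.single i 1)
      (EuclideanSpace.single j 1)) = hessianMatrix W 0 := by
    ext i j; rw [hessianMatrix_apply hd]; rfl
  have hnorm : x.ofLp ⬝ᵥ x.ofLp = ‖x‖ ^ 2 := by
    simp [EuclideanSpace.real_norm_sq_eq, dotProduct, ← pow_two]
  have hgrad : inner ℝ (gradient W 0) x = fderiv ℝ W 0 x := by simp [gradient]
  rw [bilin_self_eq_dotProduct_mulVec, hH]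
  simp only [correctedPotential, correctionMatrix, Matrix.add_mulVec, Matrix.neg_mulVec,
    Matrix.smul_mulVec, Matrix.one_mulVec, dotProduct_add, dotProduct_neg, dotProduct_smul, hnorm,
    hgrad, smul_eq_mul]
  simp
  ring

theorem diskPoissonKernel_denom {p : EuclideanSpace ℝ (Fin 2)} (θ : ℝ) :
    (p 0 - Real.cos θ) ^ 2 + (p 1 - Real.sin θ) ^ 2
      = 1 - 2 * (p 0 * Real.cos θ + p 1 * Real.sin θ) + ‖p‖ ^ 2 := by
  rw [EuclideanSpace.real_norm_sq_eq, Fin.sum_univ_two]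
  linear_combination Real.cos_sq_add_sin_sq θ

theorem abs_mul_cos_add_mul_sin_le (x y θ : ℝ) :
    |x * Real.cos θ + y * Real.sin θ| ≤ √(x ^ 2 + y ^ 2) := by
  apply Real.abs_le_sqrt
  nlinarith [sq_nonneg (x * Real.sin θ - y * Real.cos θ), Real.cos_sq_add_sin_sq θ]

theorem abs_mul_cos_add_mul_sin_le_norm (p : EuclideanSpace ℝ (Fin 2)) (θ : ℝ) :
    |p 0 * Real.cos θ + p 1 * Real.sin θ| ≤ ‖p‖ := by
  simpa [EuclideanSpace.norm_eq] using abs_mul_cos_add_mul_sin_le (p 0) (p 1) θ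

theorem quarter_le_diskPoissonKernel_denom {p : EuclideanSpace ℝ (Fin 2)} (hp : ‖p‖ ≤ 1 / 2)
    (θ : ℝ) : 1 / 4 ≤ (p 0 - Real.cos θ) ^ 2 + (p 1 - Real.sin θ) ^ 2 := by
  rw [diskPoissonKernel_denom]
  nlinarith [(abs_le.1 (abs_mul_cos_add_mul_sin_le_norm p θ)).2]

/-- The terms of order at most two in the expansion of the Poisson kernel at the origin. -/
noncomputable def diskPoissonKernelTaylor (p : EuclideanSpace ℝ (Fin 2)) (θ : ℝ) : ℝ :=
  1 + 2 * (p 0 * Real.cos θ + p 1 * Real.sin θ)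
    + 2 * ((p 0 ^ 2 - p 1 ^ 2) * Real.cos (2 * θ) + 2 * p 0 * p 1 * Real.sin (2 * θ))

theorem abs_diskPoissonKernel_sub_taylor_le {p : EuclideanSpace ℝ (Fin 2)} (hp : ‖p‖ ≤ 1 / 2)
    (θ : ℝ) : |diskPoissonKernel p θ - diskPoissonKernelTaylor p θ| ≤ 80 * ‖p‖ ^ 3 := by
  have hD := quarter_le_diskPoissonKernel_denom hp θ
  have ht := abs_mul_cos_add_mul_sin_le_norm p θ
  have hr := EuclideanSpace.real_norm_sq_eq p
  rw [Fin.sum_univ_two] at hr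
  have hquad : (p 0 ^ 2 - p 1 ^ 2) * Real.cos (2 * θ) + 2 * p 0 * p 1 * Real.sin (2 * θ)
      = 2 * (p 0 * Real.cos θ + p 1 * Real.sin θ) ^ 2 - ‖p‖ ^ 2 := by
    rw [Real.cos_two_mul, Real.sin_two_mul, hr]
    linear_combination (-2 * p 1 ^ 2) * Real.cos_sq_add_sin_sq θ
  have hnum : 1 - p 0 ^ 2 - p 1 ^ 2 = 1 - ‖p‖ ^ 2 := by rw [hr]; ring
  rw [diskPoissonKernel, diskPoissonKernelTaylor, hquad, hnum]
  rw [diskPoissonKernel_denom] at hD ⊢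
  set t := p 0 * Real.cos θ + p 1 * Real.sin θ
  set r := ‖p‖
  have hr0 : 0 ≤ r := norm_nonneg p
  have hD0 : 0 < 1 - 2 * t + r ^ 2 := by linarith
  have hEq : (1 - r ^ 2) / (1 - 2 * t + r ^ 2) - (1 + 2 * t + 2 * (2 * t ^ 2 - r ^ 2))
      = (8 * t ^ 3 - 6 * t * r ^ 2 - 4 * t ^ 2 * r ^ 2 + 2 * r ^ 4) / (1 - 2 * t + r ^ 2) := by
    field_simp
    ring
  rw [hEq, abs_div, abs_of_pos hD0, div_le_iff₀ hD0]
  have ht2 : t ^ 2 ≤ r ^ 2 := sq_le_sq' (by linarith [(abs_le.1 ht).1]) (abs_le.1 ht).2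
  have ht3 : |t ^ 3| ≤ r ^ 3 := by
    rw [abs_pow]; exact pow_le_pow_left₀ (abs_nonneg t) ht 3
  have htr : |t * r ^ 2| ≤ r ^ 3 := by
    rw [abs_mul, abs_of_nonneg (sq_nonneg r)]
    nlinarith [mul_le_mul_of_nonneg_right ht (sq_nonneg r)]
  have h4 : r ^ 4 ≤ r ^ 3 := pow_le_pow_of_le_one hr0 (by linarith) (by norm_num)
  have htr2 : t ^ 2 * r ^ 2 ≤ r ^ 3 := by
    nlinarith [mul_le_mul_of_nonneg_right ht2 (sq_nonneg r)]
  have htr0 : 0 ≤ t ^ 2 * r ^ 2 := by positivity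
  have hr4 : 0 ≤ r ^ 4 := by positivity
  have hr3 : 0 ≤ r ^ 3 := by positivity
  have hlow : 20 * r ^ 3 ≤ 80 * r ^ 3 * (1 - 2 * t + r ^ 2) := by
    nlinarith [mul_le_mul_of_nonneg_left hD hr3]
  rw [abs_le] at ht3 htr ⊢
  constructor <;> linarith [ht3.1, ht3.2, htr.1, htr.2]

theorem integral_mul_diskPoissonKernelTaylor {α : ℝ → ℝ}
    (hα : IntervalIntegrable α volume 0 (2 * Real.pi)) (p : EuclideanSpace ℝ (Fin 2)) :
    1 / (2 * Real.pi) * ∫ θ in (0 : ℝ)..(2 * Real.pi), α θ * diskPoissonKernelTaylor p θ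
      = diskPoissonIntegral α 0 + (fourierCosCoeff α 1 * p 0 + fourierSinCoeff α 1 * p 1)
        + (fourierCosCoeff α 2 * (p 0 ^ 2 - p 1 ^ 2) + fourierSinCoeff α 2 * (2 * p 0 * p 1)) := by
  have hc : ∀ k : ℕ, IntervalIntegrable (fun θ => α θ * Real.cos (k * θ)) volume 0 (2 * Real.pi) :=
    fun k => hα.mul_continuousOn (by fun_prop)
  have hs : ∀ k : ℕ, IntervalIntegrable (fun θ => α θ * Real.sin (k * θ)) volume 0 (2 * Real.pi) :=
    fun k => hα.mul_continuousOn (by fun_prop)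
  have h0 : diskPoissonIntegral α 0
      = 1 / (2 * Real.pi) * ∫ θ in (0 : ℝ)..(2 * Real.pi), α θ := by
    simp [diskPoissonIntegral, diskPoissonKernel]
  have hsplit : ∀ θ, α θ * diskPoissonKernelTaylor p θ
      = α θ + 2 * p 0 * (α θ * Real.cos ((1 : ℕ) * θ)) + 2 * p 1 * (α θ * Real.sin ((1 : ℕ) * θ))
        + 2 * (p 0 ^ 2 - p 1 ^ 2) * (α θ * Real.cos ((2 : ℕ) * θ))
        + 4 * p 0 * p 1 * (α θ * Real.sin ((2 : ℕ) * θ)) := by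
    intro θ
    simp only [diskPoissonKernelTaylor, Nat.cast_one, one_mul, Nat.cast_ofNat]
    ring
  simp only [hsplit]
  have i1 := (hc 1).const_mul (2 * p 0)
  have i2 := (hs 1).const_mul (2 * p 1)
  have i3 := (hc 2).const_mul (2 * (p 0 ^ 2 - p 1 ^ 2))
  have i4 := (hs 2).const_mul (4 * p 0 * p 1)
  rw [intervalIntegral.integral_add (((hα.add i1).add i2).add i3) i4,
    intervalIntegral.integral_add ((hα.add i1).add i2) i3,
    intervalIntegral.integral_add (hα.add i1) i2, intervalIntegral.integral_add hα i1]
  simp only [intervalIntegral.integral_const_mul, h0, fourierCosCoeff, fourierSinCoeff]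
  field_simp
  ring

theorem abs_diskPoissonIntegral_sub_le {α : ℝ → ℝ}
    (hα : IntervalIntegrable α volume 0 (2 * Real.pi)) {p : EuclideanSpace ℝ (Fin 2)}
    (hp : ‖p‖ ≤ 1 / 2) :
    |diskPoissonIntegral α p - (diskPoissonIntegral α 0
        + (fourierCosCoeff α 1 * p 0 + fourierSinCoeff α 1 * p 1)
        + (fourierCosCoeff α 2 * (p 0 ^ 2 - p 1 ^ 2) + fourierSinCoeff α 2 * (2 * p 0 * p 1)))|
      ≤ 1 / (2 * Real.pi) * (∫ θ in (0 : ℝ)..(2 * Real.pi), |α θ|) * 80 * ‖p‖ ^ 3 := by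
  have hpi : 0 ≤ 2 * Real.pi := by positivity
  have hK : Continuous fun θ => diskPoissonKernel p θ := by
    unfold diskPoissonKernel
    refine Continuous.div (by fun_prop) (by fun_prop) fun θ => ?_
    linarith [quarter_le_diskPoissonKernel_denom hp θ]
  have hT : Continuous fun θ => diskPoissonKernelTaylor p θ := by
    unfold diskPoissonKernelTaylor
    fun_prop
  rw [← integral_mul_diskPoissonKernelTaylor hα, diskPoissonIntegral, ← mul_sub,
    ← intervalIntegral.integral_sub (hα.mul_continuousOn hK.continuousOn)
      (hα.mul_continuousOn hT.continuousOn), abs_mul, abs_of_nonneg (by positivity), mul_assoc,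
    mul_assoc]
  refine mul_le_mul_of_nonneg_left ?_ (by positivity)
  rw [← intervalIntegral.integral_mul_const, ← Real.norm_eq_abs]
  refine intervalIntegral.norm_integral_le_of_norm_le hpi (ae_of_all _ fun θ _ => ?_)
    (hα.abs.mul_const _)
  rw [← mul_sub, norm_mul, Real.norm_eq_abs, Real.norm_eq_abs]
  exact mul_le_mul_of_nonneg_left (abs_diskPoissonKernel_sub_taylor_le hp θ) (abs_nonneg _)

theorem diskPoissonIntegral_isLittleO {α : ℝ → ℝ}
    (hα : IntervalIntegrable α volume 0 (2 * Real.pi)) {h : EuclideanSpace ℝ (Fin 2) → ℝ}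
    (hh : ∀ p ∈ Metric.ball (0 : EuclideanSpace ℝ (Fin 2)) 1, h p = diskPoissonIntegral α p)
    (ha₁ : fourierCosCoeff α 1 = 0) (hb₁ : fourierSinCoeff α 1 = 0) :
    (fun p => h p - h 0
        - (fourierCosCoeff α 2 * (p 0 ^ 2 - p 1 ^ 2) + fourierSinCoeff α 2 * (2 * p 0 * p 1)))
      =o[𝓝 0] fun p => ‖p‖ ^ 2 := by
  have hO : (fun p => h p - h 0
        - (fourierCosCoeff α 2 * (p 0 ^ 2 - p 1 ^ 2) + fourierSinCoeff α 2 * (2 * p 0 * p 1)))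
      =O[𝓝 0] fun p => ‖p‖ ^ 3 := by
    refine Asymptotics.IsBigO.of_bound
      (1 / (2 * Real.pi) * (∫ θ in (0 : ℝ)..(2 * Real.pi), |α θ|) * 80) ?_
    filter_upwards [Metric.ball_mem_nhds 0 (show (0 : ℝ) < 1 / 2 by norm_num)] with p hp
    have hp' : ‖p‖ < 1 / 2 := by simpa using hp
    have hbound := abs_diskPoissonIntegral_sub_le hα hp'.le
    rw [hh p (by simpa using hp'.trans (by norm_num)), hh 0 (by simp), Real.norm_eq_abs,
      Real.norm_eq_abs, abs_of_nonneg (pow_nonneg (norm_nonneg p) 3)]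
    rw [ha₁, hb₁] at hbound
    convert hbound using 2
    ring
  refine hO.trans_isLittleO ?_
  exact Asymptotics.isLittleO_norm_pow_norm_pow (E' := EuclideanSpace ℝ (Fin 2)) (by norm_num)

theorem abs_harmonic_quadratic_le (a b : ℝ) (p : EuclideanSpace ℝ (Fin 2)) :
    |a * (p 0 ^ 2 - p 1 ^ 2) + b * (2 * p 0 * p 1)| ≤ √(a ^ 2 + b ^ 2) * ‖p‖ ^ 2 := by
  have hr := EuclideanSpace.real_norm_sq_eq p
  rw [Fin.sum_univ_two] at hr
  have hs : √((a ^ 2 + b ^ 2) * (‖p‖ ^ 2) ^ 2) = √(a ^ 2 + b ^ 2) * ‖p‖ ^ 2 := by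
    rw [Real.sqrt_mul (by positivity), Real.sqrt_sq (by positivity)]
  rw [← hs, hr]
  apply Real.abs_le_sqrt
  nlinarith [sq_nonneg (a * (2 * p 0 * p 1) - b * (p 0 ^ 2 - p 1 ^ 2))]

theorem hasFDerivAt_zero_of_eqOn_diskPoissonIntegral {α : ℝ → ℝ}
    (hα : IntervalIntegrable α volume 0 (2 * Real.pi)) {h : EuclideanSpace ℝ (Fin 2) → ℝ}
    (hh : ∀ p ∈ Metric.ball (0 : EuclideanSpace ℝ (Fin 2)) 1, h p = diskPoissonIntegral α p)
    (ha₁ : fourierCosCoeff α 1 = 0) (hb₁ : fourierSinCoeff α 1 = 0) :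
    HasFDerivAt h (0 : EuclideanSpace ℝ (Fin 2) →L[ℝ] ℝ) 0 := by
  have hQ : (fun p : EuclideanSpace ℝ (Fin 2) =>
      fourierCosCoeff α 2 * (p 0 ^ 2 - p 1 ^ 2) + fourierSinCoeff α 2 * (2 * p 0 * p 1))
      =O[𝓝 0] fun p => ‖p‖ ^ 2 := by
    refine Asymptotics.IsBigO.of_bound
      √(fourierCosCoeff α 2 ^ 2 + fourierSinCoeff α 2 ^ 2) (Eventually.of_forall fun p => ?_)
    rw [Real.norm_eq_abs, Real.norm_eq_abs, abs_of_nonneg (sq_nonneg ‖p‖)]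
    exact abs_harmonic_quadratic_le _ _ p
  have hO := (diskPoissonIntegral_isLittleO hα hh ha₁ hb₁).isBigO.add hQ
  simp only [sub_add_cancel] at hO
  have := hO.trans_isLittleO
    (Asymptotics.isLittleO_norm_pow_id (E' := EuclideanSpace ℝ (Fin 2)) one_lt_two)
  rw [hasFDerivAt_iff_isLittleO]
  simpa using this

theorem mainTheorem9
    (Ω : Set (EuclideanSpace ℝ (Fin 2))) (hΩ : IsOpen Ω) (hΩ0 : (0 : EuclideanSpace ℝ (Fin 2)) ∈ Ω)
    (F : EuclideanSpace ℝ (Fin 2) → EuclideanSpace ℝ (Fin 2))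
    (hF : ContDiffOn ℝ 2 F Ω) (hF0 : F 0 = 0)
    (α : ℝ → ℝ) (hα : IntervalIntegrable α volume 0 (2 * Real.pi))
    (h : EuclideanSpace ℝ (Fin 2) → ℝ)
    (hh : ∀ p ∈ Metric.ball (0 : EuclideanSpace ℝ (Fin 2)) 1, h p = diskPoissonIntegral α p)
    (ha₁ : fourierCosCoeff α 1 = 0) (hb₁ : fourierSinCoeff α 1 = 0) :
    (∀ (V : EuclideanSpace ℝ (Fin 2) → ℝ)
        (u : EuclideanSpace ℝ (Fin 2) → EuclideanSpace ℝ (Fin 2)),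
        IsHHD Ω F V u → IsLocalMin V 0 →
        HasGradientAt (fun p => V p + h p) 0 0) ∧
    (vfDivergence F 0 < 0 →
      ∀ V : EuclideanSpace ℝ (Fin 2) → ℝ, IsConstructedPotential Ω F V →
        fourierCosCoeff α 2 ^ 2 + fourierSinCoeff α 2 ^ 2
            < (jacobianMatrix F 0).trace ^ 2 / 64 →
        IsLocalMin (fun p => V p + h p) 0 ∧
        ∀ᶠ p in 𝓝[≠] (0 : EuclideanSpace ℝ (Fin 2)), V 0 + h 0 < V p + h p) := by
  have hhd := hasFDerivAt_zero_of_eqOn_diskPoissonIntegral hα hh ha₁ hb₁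
  refine ⟨fun V u hV hmin => ?_, fun hdiv V hV hab => ?_⟩
  · have hVd : DifferentiableAt ℝ V 0 :=
      (hV.contDiffOn_potential.contDiffAt (hΩ.mem_nhds hΩ0)).differentiableAt (by norm_num)
    have hV0 := hVd.hasFDerivAt
    rw [hmin.fderiv_eq_zero] at hV0
    rw [hasGradientAt_iff_hasFDerivAt]
    have hVh := hV0.fun_add hhd
    rw [add_zero] at hVh
    rwa [map_zero]
  · obtain ⟨W, w, hW, hVW⟩ := hV
    have hΩn := hΩ.mem_nhds hΩ0
    have htr := hW.trace_hessianMatrix hΩ hF hΩ0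
    have hWo := correctedPotential_isLittleO
      ((hW.contDiffOn_potential.contDiffAt hΩn).of_le (by norm_num))
    have hho := diskPoissonIntegral_isLittleO hα hh ha₁ hb₁
    have hjac : (jacobianMatrix F 0).trace = vfDivergence F 0 := rfl
    rw [hjac] at hab
    rw [htr] at hWo
    set d := vfDivergence F 0
    set s := √(fourierCosCoeff α 2 ^ 2 + fourierSinCoeff α 2 ^ 2) with hs
    have hs8 : s < -d / 8 := by
      rw [hs, Real.sqrt_lt' (by linarith)]
      linarith
    have hε : 0 < -d / 16 := by linarith
    have hstrict : ∀ᶠ p in 𝓝[≠] (0 : EuclideanSpace ℝ (Fin 2)), V 0 + h 0 < V p + h p := by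
      filter_upwards [nhdsWithin_le_nhds ((hWo.add hho).def hε), nhdsWithin_le_nhds hΩn,
        self_mem_nhdsWithin] with p hp hpΩ hp0
      have hpos : 0 < ‖p‖ ^ 2 := pow_pos (norm_pos_iff.2 hp0) 2
      rw [Real.norm_eq_abs, Real.norm_eq_abs, abs_of_pos hpos] at hp
      have hq := abs_harmonic_quadratic_le (fourierCosCoeff α 2) (fourierSinCoeff α 2) p
      rw [← hs] at hq
      rw [hVW hpΩ, hVW hΩ0]
      have h1 := (abs_le.1 hp).1
      have h2 := (abs_le.1 hq).1
      push_cast at h1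
      nlinarith [mul_lt_mul_of_pos_right hs8 hpos]
    refine ⟨?_, hstrict⟩
    have hle := eventually_nhdsWithin_iff.1 hstrict
    filter_upwards [hle] with p hp
    by_cases hp0 : p = 0
    · rw [hp0]
    · exact (hp hp0).le
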